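/- Let $\mathcal H$ be a separable complex Hilbert space, and let $\mathcal P_{\infty,\infty}$ be the set of orthogonal projections $P=P^2=P^*\in\mathcal B(\mathcal H)$ whose range $R(P)$ and nullspace $N(P)$ are both infinite-dimensional. Two closed subspaces $\mathcal S,\mathcal T\subset\mathcal H$ have a common complement if there is a closed subspace $\mathcal Z\subset\mathcal H$ with $\mathcal S\dot+\mathcal Z=\mathcal T\dot+\mathcal Z=\mathcal H$, where $\dot+$ denotes the direct (not necessarily orthogonal) sum. Let $$\boldsymbol\Delta_\infty=\{(P,Q)\in\mathcal P_{\infty,\infty}\times\mathcal P_{\infty,\infty}: R(P)\text{ and }R(Q)\text{ have a common complement}\}.$$ Then $\boldsymbol\Delta_\infty$ is dense in $\mathcal P_{\infty,\infty}\times\mathcal P_{\infty,\infty}$ with respect to the topology induced by the operator norm. -/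

import Mathlib

/-- Two subspaces `S`, `T` of `H` have a common complement: there is a closed subspace `Z` with
`S ∔ Z = T ∔ Z = H` (direct, not necessarily orthogonal, sums). -/
def HaveCommonComplement {H : Type*} [NormedAddCommGroup H] [InnerProductSpace ℂ H]
    (S T : Submodule ℂ H) : Prop :=
  ∃ Z : Submodule ℂ H, IsClosed (Z : Set H) ∧ IsCompl S Z ∧ IsCompl T Z

/-- `Δ`: the pairs of orthogonal projections whose ranges have a common complement. -/
def commonComplementPairs (H : Type*) [NormedAddCommGroup H] [InnerProductSpace ℂ H]
    [CompleteSpace H] : Set ((H →L[ℂ] H) × (H →L[ℂ] H)) :=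
  {x | IsStarProjection x.1 ∧ IsStarProjection x.2 ∧
    HaveCommonComplement (LinearMap.range (x.1 : H →ₗ[ℂ] H)) (LinearMap.range (x.2 : H →ₗ[ℂ] H))}

/-- `P_{∞,∞}`: the orthogonal projections of infinite rank and infinite corank. -/
def infProjections (H : Type*) [NormedAddCommGroup H] [InnerProductSpace ℂ H]
    [CompleteSpace H] : Set (H →L[ℂ] H) :=
  {P | IsStarProjection P ∧ ¬ FiniteDimensional ℂ (LinearMap.range (P : H →ₗ[ℂ] H)) ∧
    ¬ FiniteDimensional ℂ (LinearMap.ker (P : H →ₗ[ℂ] H))}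

/-- `Δ_∞`: the pairs in `Δ` both of whose members lie in `P_{∞,∞}`. -/
def commonComplementPairsInf (H : Type*) [NormedAddCommGroup H] [InnerProductSpace ℂ H]
    [CompleteSpace H] : Set ((H →L[ℂ] H) × (H →L[ℂ] H)) :=
  commonComplementPairs H ∩ infProjections H ×ˢ infProjections H

/-!
If `Q P (1 - Q)` is not compact, then it is bounded below on an isometric copy of `ℓ²`. This leaves
enough room in the range of `P` for a bounded operator onto that range which is the identity on it
and bijective on the range of `Q`; its kernel is a common complement.

Non-compactness of `Q P (1 - Q)` is reached by arbitrarily small unitary rotations of `Q`. Otherwise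
the derivative of `Q ↦ Q P (1 - Q)` along every rotation would be compact, hence zero in the Calkin
algebra. As the Calkin algebra is a prime ring, this forces one of the projections `P`, `1 - P`,
`Q`, `1 - Q` to be zero there, that is, to have finite rank.
-/

open scoped lp InnerProductSpace

section HilbertSpace

variable {𝕜 E F : Type*} [RCLike 𝕜] [NormedAddCommGroup E] [InnerProductSpace 𝕜 E]
  [NormedAddCommGroup F] [InnerProductSpace 𝕜 F]

theorem countable_of_orthonormal [TopologicalSpace.SeparableSpace E] {ι : Type*} {v : ι → E}
    (hv : Orthonormal 𝕜 v) : Countable ι := by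
  refine Pairwise.countable_of_isOpen_disjoint (s := fun i => Metric.ball (v i) (1 / 2))
    (fun i j hij => Metric.ball_disjoint_ball ?_)
    (fun _ => Metric.isOpen_ball) (fun i => Metric.nonempty_ball.2 one_half_pos)
  have hdist : ‖v i - v j‖ ^ 2 = 2 := by
    rw [@norm_sub_sq 𝕜, hv.1 i, hv.1 j, hv.2 hij, map_zero]
    norm_num
  rw [dist_eq_norm]
  nlinarith [norm_nonneg (v i - v j)]

theorem nonempty_hilbertBasis_nat [CompleteSpace E] [TopologicalSpace.SeparableSpace E]
    (hE : ¬ FiniteDimensional 𝕜 E) : Nonempty (HilbertBasis ℕ 𝕜 E) := by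
  obtain ⟨w, b, -⟩ := exists_hilbertBasis 𝕜 E
  have : Countable w := countable_of_orthonormal b.orthonormal
  have : Infinite w := not_finite_iff_infinite.1 fun _ =>
    have := Fintype.ofFinite w
    hE b.toOrthonormalBasis.toBasis.finiteDimensional_of_finite
  obtain ⟨e⟩ := nonempty_equiv_of_countable (α := ℕ) (β := w)
  refine ⟨HilbertBasis.mk (b.orthonormal.comp e e.injective) ?_⟩
  rw [e.surjective.range_comp, b.dense_span]

theorem nonempty_linearIsometryEquiv_of_not_finiteDimensional
    [CompleteSpace E] [TopologicalSpace.SeparableSpace E]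
    [CompleteSpace F] [TopologicalSpace.SeparableSpace F]
    (hE : ¬ FiniteDimensional 𝕜 E) (hF : ¬ FiniteDimensional 𝕜 F) : Nonempty (E ≃ₗᵢ[𝕜] F) := by
  obtain ⟨b⟩ := nonempty_hilbertBasis_nat hE
  obtain ⟨c⟩ := nonempty_hilbertBasis_nat hF
  exact ⟨b.repr.trans c.repr.symm⟩

theorem not_finiteDimensional_lp_two (ι : Type*) [Infinite ι] :
    ¬ FiniteDimensional 𝕜 ℓ²(ι, 𝕜) := fun _ =>
  have b : HilbertBasis ι 𝕜 ℓ²(ι, 𝕜) := ⟨LinearIsometryEquiv.refl 𝕜 _⟩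
  not_finite_iff_infinite.2 ‹_› b.orthonormal.linearIndependent.finite

theorem exists_linearIsometry_not_finiteDimensional_orthogonal_range
    [CompleteSpace E] [TopologicalSpace.SeparableSpace E]
    [CompleteSpace F] [TopologicalSpace.SeparableSpace F] (hE : ¬ FiniteDimensional 𝕜 E) :
    ∃ W : F →ₗᵢ[𝕜] E, ¬ FiniteDimensional 𝕜 (LinearMap.range W.toLinearMap)ᗮ := by
  let fromProd := (WithLp.linearEquiv 2 𝕜 (F × E)).symm.toLinearMap
  have hprod : ¬ FiniteDimensional 𝕜 (WithLp 2 (F × E)) := fun _ =>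
    hE (.of_injective (fromProd ∘ₗ LinearMap.inr 𝕜 F E) fun x y h => by simpa [fromProd] using h)
  obtain ⟨V⟩ := nonempty_linearIsometryEquiv_of_not_finiteDimensional hprod hE
  let W : F →ₗᵢ[𝕜] E := V.toLinearIsometry.comp
    ⟨fromProd ∘ₗ LinearMap.inl 𝕜 F E, WithLp.norm_toLp_fst 2 F E⟩
  have horth (y : E) : V (.toLp 2 (0, y)) ∈ (LinearMap.range W.toLinearMap)ᗮ := by
    rintro _ ⟨x, rfl⟩
    exact (V.inner_map_map _ _).trans (by simp [fromProd])
  let ι := (V.toLinearEquiv.toLinearMap ∘ₗ fromProd ∘ₗ LinearMap.inr 𝕜 F E).codRestrict _ horth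
  refine ⟨W, fun _ => hE (.of_injective ι fun x y h => ?_)⟩
  have hxy : fromProd (0, x) = fromProd (0, y) := V.injective (congrArg Subtype.val h)
  simpa [fromProd] using hxy

theorem hasLeftInverse_of_antilipschitzWith [CompleteSpace E] [CompleteSpace F] {K : NNReal}
    {A : E →L[𝕜] F} (hA : AntilipschitzWith K A) : A.HasLeftInverse :=
  have : CompleteSpace A.range := hA.completeSpace_range_clm
  .of_injective_of_isClosed_range_of_closedComplement_range hA.injective
    (hA.isClosed_range A.uniformContinuous)
    ⟨A.range.orthogonalProjectionOnto, Submodule.orthogonalProjectionOnto_mem_subspace_eq_self⟩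

end HilbertSpace

section Compact

theorem finiteDimensional_of_isCompactOperator_of_hasLeftInverse {𝕜 E F : Type*}
    [NontriviallyNormedField 𝕜] [CompleteSpace 𝕜] [NormedAddCommGroup E] [NormedSpace 𝕜 E]
    [NormedAddCommGroup F] [NormedSpace 𝕜 F] {A : E →L[𝕜] F} (hA : IsCompactOperator A)
    (hinv : A.HasLeftInverse) : FiniteDimensional 𝕜 E := by
  obtain ⟨L, hL⟩ := hinv
  refine FiniteDimensional.of_isCompactOperator_id (𝕜 := 𝕜) ?_
  rw [← hL.comp_eq_id]
  exact hA.clm_comp L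

theorem isCompactOperator_iff_finiteDimensional_range_of_isIdempotentElem {𝕜 E : Type*}
    [NontriviallyNormedField 𝕜] [ProperSpace 𝕜] [NormedAddCommGroup E] [NormedSpace 𝕜 E]
    {P : E →L[𝕜] E} (hP : IsIdempotentElem P) :
    IsCompactOperator P ↔ FiniteDimensional 𝕜 P.range := by
  refine ⟨fun h => ?_, fun _ => ?_⟩
  · refine finiteDimensional_of_isCompactOperator_of_hasLeftInverse
      (A := P ∘L P.range.subtypeL) (h.comp_clm _) ⟨P.rangeRestrict, ?_⟩
    rintro ⟨_, x, rfl⟩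
    have hPP (y : E) : P (P y) = P y := DFunLike.congr_fun hP.eq y
    exact Subtype.ext ((hPP (P x)).trans (hPP x))
  · have : ProperSpace P.range := FiniteDimensional.proper 𝕜 _
    exact (isCompactOperator_of_locallyCompactSpace_dom P.rangeRestrict).clm_comp P.range.subtypeL

variable {𝕜 E F : Type*} [RCLike 𝕜] [NormedAddCommGroup E] [InnerProductSpace 𝕜 E]
  [NormedAddCommGroup F] [InnerProductSpace 𝕜 F]

theorem exists_forall_finiteDimensional_exists_mem_orthogonal_lt_norm [CompleteSpace F]
    {A : E →L[𝕜] F} (hA : ¬ IsCompactOperator A) :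
    ∃ δ > 0, ∀ V : Submodule 𝕜 E, FiniteDimensional 𝕜 V → ∃ x ∈ Vᗮ, δ * ‖x‖ < ‖A x‖ := by
  by_contra! h
  refine hA (isClosed_setOfPred_isCompactOperator.closure_subset (Metric.mem_closure_iff.2 ?_))
  intro ε hε
  obtain ⟨V, hV, hAV⟩ := h (ε / 2) (by positivity)
  have hcompact : IsCompactOperator V.orthogonalProjectionOnto :=
    isCompactOperator_of_locallyCompactSpace_dom _
  refine ⟨A ∘L V.starProjection, hcompact.clm_comp (A ∘L V.subtypeL), ?_⟩
  rw [dist_eq_norm]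
  refine (ContinuousLinearMap.opNorm_le_bound _ (half_pos hε).le fun x => ?_).trans_lt
    (half_lt_self hε)
  calc ‖(A - A ∘L V.starProjection) x‖ = ‖A (Vᗮ.starProjection x)‖ := by
        simp [Submodule.starProjection_orthogonal_val]
    _ ≤ ε / 2 * ‖Vᗮ.starProjection x‖ := hAV _ (Submodule.starProjection_apply_mem _ _)
    _ ≤ ε / 2 * ‖x‖ := by gcongr; exact Submodule.norm_starProjection_apply_le _ _

theorem exists_orthonormal_nat_inner_map_eq_zero [CompleteSpace E] [CompleteSpace F]
    {A : E →L[𝕜] F} (hA : ¬ IsCompactOperator A) :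
    ∃ δ > 0, ∃ v : ℕ → E, Orthonormal 𝕜 v ∧ (∀ n, δ ≤ ‖A (v n)‖) ∧
      Pairwise fun m n => ⟪A (v m), A (v n)⟫_𝕜 = 0 := by
  classical
  obtain ⟨δ, hδ, h⟩ := exists_forall_finiteDimensional_exists_mem_orthogonal_lt_norm hA
  obtain ⟨v, hv, hvr⟩ := exists_seq_of_forall_finset_exists
    (fun x : E => ‖x‖ = 1 ∧ δ ≤ ‖A x‖) (fun x y => ⟪x, y⟫_𝕜 = 0 ∧ ⟪A x, A y⟫_𝕜 = 0) (by
      rintro s -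
      obtain ⟨x, hx, hxA⟩ := h
        (Submodule.span 𝕜 ((s ∪ s.image (A.adjoint ∘L A) : Finset E) : Set E)) inferInstance
      have hx0 : x ≠ 0 := by
        rintro rfl
        simp at hxA
      refine ⟨(‖x‖⁻¹ : 𝕜) • x, ⟨norm_smul_inv_norm hx0, ?_⟩, fun y hy => ⟨?_, ?_⟩⟩
      · rw [map_smul, norm_smul, norm_inv, RCLike.norm_ofReal, abs_norm, ← div_eq_inv_mul,
          le_div_iff₀ (norm_pos_iff.2 hx0)]
        exact hxA.le
      · rw [inner_smul_right, hx y (Submodule.subset_span (by simp [hy])), mul_zero]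
      · have hAy := hx (A.adjoint (A y)) (Submodule.subset_span (Finset.mem_coe.2
          (Finset.mem_union_right _ (Finset.mem_image_of_mem (A.adjoint ∘L A) hy))))
        rw [ContinuousLinearMap.adjoint_inner_left] at hAy
        rw [map_smul, inner_smul_right, hAy, mul_zero])
  have hpair : ∀ m n, m ≠ n → ⟪v m, v n⟫_𝕜 = 0 ∧ ⟪A (v m), A (v n)⟫_𝕜 = 0 := by
    intro m n hmn
    rcases hmn.lt_or_gt with hlt | hlt
    · exact hvr m n hlt
    · exact (hvr n m hlt).imp inner_eq_zero_symm.1 inner_eq_zero_symm.1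
  exact ⟨δ, hδ, v, ⟨fun n => (hv n).1, fun m n hmn => (hpair m n hmn).1⟩, fun n => (hv n).2,
    fun m n hmn => (hpair m n hmn).2⟩

theorem norm_sum_smul_sq_of_pairwise_inner_eq_zero {ι : Type*} {v : ι → E}
    (hv : Pairwise fun i j => ⟪v i, v j⟫_𝕜 = 0) (c : ι → 𝕜) (s : Finset ι) :
    ‖∑ i ∈ s, c i • v i‖ ^ 2 = ∑ i ∈ s, (‖c i‖ * ‖v i‖) ^ 2 := by
  classical
  induction s using Finset.induction_on with
  | empty => simp
  | insert i s hi ih =>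
    have horth : ⟪c i • v i, ∑ j ∈ s, c j • v j⟫_𝕜 = 0 := by
      rw [inner_sum]
      refine Finset.sum_eq_zero fun j hj => ?_
      rw [inner_smul_left, inner_smul_right, hv (ne_of_mem_of_not_mem hj hi).symm, mul_zero,
        mul_zero]
    rw [Finset.sum_insert hi, Finset.sum_insert hi, ← ih, ← norm_smul, sq, sq, sq,
      norm_add_sq_eq_norm_sq_add_norm_sq_of_inner_eq_zero _ _ horth]

theorem mul_norm_sum_smul_le_norm_sum_smul {ι : Type*} {v : ι → E} {w : ι → F}
    (hv : Orthonormal 𝕜 v) (hw : Pairwise fun i j => ⟪w i, w j⟫_𝕜 = 0) {δ : ℝ} (hδ : 0 ≤ δ)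
    (hδw : ∀ i, δ ≤ ‖w i‖) (c : ι → 𝕜) (s : Finset ι) :
    δ * ‖∑ i ∈ s, c i • v i‖ ≤ ‖∑ i ∈ s, c i • w i‖ := by
  refine le_of_sq_le_sq ?_ (norm_nonneg _)
  rw [mul_pow, norm_sum_smul_sq_of_pairwise_inner_eq_zero hv.2,
    norm_sum_smul_sq_of_pairwise_inner_eq_zero hw, Finset.mul_sum]
  refine Finset.sum_le_sum fun i _ => ?_
  rw [hv.1 i, mul_one, ← mul_pow, mul_comm]
  gcongr
  exact hδw i

theorem mul_norm_le_norm_linearIsometry [CompleteSpace E] {ι : Type*} {v : ι → E}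
    (hv : Orthonormal 𝕜 v) {A : E →L[𝕜] F} {δ : ℝ} (hδ : 0 ≤ δ) (hAv : ∀ i, δ ≤ ‖A (v i)‖)
    (horth : Pairwise fun i j => ⟪A (v i), A (v j)⟫_𝕜 = 0) (x : ℓ²(ι, 𝕜)) :
    δ * ‖x‖ ≤ ‖A (hv.orthogonalFamily.linearIsometry x)‖ := by
  have hsum := hv.orthogonalFamily.hasSum_linearIsometry x
  rw [← hv.orthogonalFamily.linearIsometry.norm_map]
  refine le_of_tendsto_of_tendsto' (hsum.norm.const_mul δ) (hsum.mapL A).norm fun s => ?_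
  simp only [LinearIsometry.toSpanSingleton_apply, map_smul]
  exact mul_norm_sum_smul_le_norm_sum_smul hv horth hδ hAv (fun i => x i) s

theorem exists_linearIsometry_hasLeftInverse_of_not_isCompactOperator [CompleteSpace E]
    [CompleteSpace F] {A : E →L[𝕜] F} (hA : ¬ IsCompactOperator A) :
    ∃ J : ℓ²(ℕ, 𝕜) →ₗᵢ[𝕜] E, (A ∘L J.toContinuousLinearMap).HasLeftInverse := by
  obtain ⟨δ, hδ, v, hv, hAv, horth⟩ := exists_orthonormal_nat_inner_map_eq_zero hA
  refine ⟨hv.orthogonalFamily.linearIsometry, hasLeftInverse_of_antilipschitzWith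
    (ContinuousLinearMap.antilipschitz_of_bound _ (K := .mk δ⁻¹ (by positivity)) fun x => ?_)⟩
  rw [NNReal.coe_mk, le_inv_mul_iff₀ hδ]
  exact mul_norm_le_norm_linearIsometry hv hδ.le hAv horth x

theorem isCompactOperator_or_isCompactOperator_of_forall_comp {D G : Type*}
    [NormedAddCommGroup D] [InnerProductSpace 𝕜 D] [CompleteSpace D] [CompleteSpace E]
    [CompleteSpace F] [NormedAddCommGroup G] [InnerProductSpace 𝕜 G] [CompleteSpace G]
    {A : F →L[𝕜] G} {B : D →L[𝕜] E} (h : ∀ Y : E →L[𝕜] F, IsCompactOperator (A ∘L Y ∘L B)) :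
    IsCompactOperator A ∨ IsCompactOperator B := by
  by_contra! ⟨hA, hB⟩
  obtain ⟨J, hJ⟩ := exists_linearIsometry_hasLeftInverse_of_not_isCompactOperator hA
  obtain ⟨J', L, hL⟩ := exists_linearIsometry_hasLeftInverse_of_not_isCompactOperator hB
  have hAJ : ⇑(A ∘L J.toContinuousLinearMap) =
      ⇑(A ∘L (J.toContinuousLinearMap ∘L L) ∘L B) ∘ ⇑J'.toContinuousLinearMap :=
    funext fun x => congrArg (fun y => A (J y)) (hL x).symm
  refine not_finiteDimensional_lp_two ℕ
    (finiteDimensional_of_isCompactOperator_of_hasLeftInverse ?_ hJ)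
  rw [hAJ]
  exact (h _).comp_clm J'.toContinuousLinearMap

end Compact

section LinearAlgebra

variable {R M N E : Type*} [Ring R] [AddCommGroup M] [Module R M] [AddCommGroup N] [Module R N]
  [AddCommGroup E] [Module R E]

theorem isCompl_ker_of_bijective_domRestrict {f : M →ₗ[R] N} {p : Submodule R M}
    (hf : Function.Bijective (f.domRestrict p)) : IsCompl p f.ker := by
  refine ⟨Submodule.disjoint_def.2 fun x hx hfx => ?_, codisjoint_iff.2 (eq_top_iff.2 ?_)⟩
  · exact congrArg Subtype.val (hf.1 (hfx.trans (map_zero f).symm) : (⟨x, hx⟩ : p) = 0)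
  · rintro x -
    obtain ⟨y, hy⟩ := hf.2 (f x)
    exact Submodule.mem_sup.2 ⟨y, y.2, x - y, LinearMap.sub_mem_ker_iff.2 hy.symm,
      add_sub_cancel _ _⟩

/-- The section `τ` of `b` splits `p` as `(p ⊓ b.ker) × E`, and the map restricts to `g` on the
first factor and to `u` on the second. -/
theorem bijective_domRestrict_of_isCompl_map_range {p : Submodule R M} {b : M →ₗ[R] E}
    {τ : E →ₗ[R] M} {g : M →ₗ[R] N} {u : E →ₗ[R] N} (hτ : ∀ e, τ e ∈ p)
    (hbτ : Function.LeftInverse b τ) (hg : Set.InjOn g (p ⊓ b.ker : Submodule R M))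
    (hu : Function.Injective u) (hgu : IsCompl ((p ⊓ b.ker).map g) u.range) :
    Function.Bijective ((g + (u - g ∘ₗ τ) ∘ₗ b).domRestrict p) := by
  have hmem {x : M} (hx : x ∈ p) : x - τ (b x) ∈ p ⊓ b.ker :=
    ⟨p.sub_mem hx (hτ _), by
      rw [SetLike.mem_coe, LinearMap.mem_ker, map_sub, hbτ, sub_self]⟩
  have hsplit (x : M) : (g + (u - g ∘ₗ τ) ∘ₗ b) x = g (x - τ (b x)) + u (b x) := by
    simp only [LinearMap.add_apply, LinearMap.comp_apply, LinearMap.sub_apply, map_sub]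
    abel
  refine ⟨(injective_iff_map_eq_zero _).2 fun x hx => ?_, fun y => ?_⟩
  · rw [LinearMap.domRestrict_apply, hsplit] at hx
    obtain ⟨hgx, hux⟩ := (Submodule.disjoint_iff_add_eq_zero.1 hgu.disjoint
      (Submodule.mem_map_of_mem (hmem x.2)) (LinearMap.mem_range_self u _)) hx
    have hbx : b x = 0 := hu (hux.trans (map_zero u).symm)
    have hxτ := hg (hmem x.2) (Submodule.zero_mem _) (hgx.trans (map_zero g).symm)
    rw [hbx, map_zero, sub_zero] at hxτ
    exact Subtype.ext hxτ
  · obtain ⟨_, ⟨t, ht, rfl⟩, _, ⟨e, rfl⟩, rfl⟩ :=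
      Submodule.mem_sup.1 (hgu.sup_eq_top ▸ Submodule.mem_top : y ∈ _)
    have hb : b (t + τ e) = e := by rw [map_add, hbτ, LinearMap.mem_ker.1 ht.2, zero_add]
    exact ⟨⟨t + τ e, p.add_mem ht.1 (hτ e)⟩, by
      rw [LinearMap.domRestrict_apply, hsplit, hb, add_sub_cancel_right]⟩

end LinearAlgebra

section CommonComplement

theorem exists_retraction_norm_eq_on_orthogonal {𝕜 H : Type*} [RCLike 𝕜] [NormedAddCommGroup H]
    [InnerProductSpace 𝕜 H] [CompleteSpace H] [TopologicalSpace.SeparableSpace H]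
    {S : Submodule 𝕜 H} [CompleteSpace S] {K : Submodule 𝕜 S} [CompleteSpace K]
    (hK : ¬ FiniteDimensional 𝕜 K) :
    ∃ g : H →L[𝕜] S, (∀ s : S, g s = s) ∧ (∀ x ∈ (K.map S.subtype)ᗮ, ‖g x‖ = ‖x‖) ∧
      ¬ FiniteDimensional 𝕜 ((K.map S.subtype)ᗮ.map g.toLinearMap)ᗮ := by
  have : SecondCountableTopology H := UniformSpace.secondCountable_of_separable H
  obtain ⟨W, hW⟩ :=
    exists_linearIsometry_not_finiteDimensional_orthogonal_range (𝕜 := 𝕜) (E := K) (F := Sᗮ) hK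
  let g : H →L[𝕜] S := S.orthogonalProjectionOnto +
    K.subtypeL ∘L W.toContinuousLinearMap ∘L Sᗮ.orthogonalProjectionOnto
  have hg (x : H) : g x = S.orthogonalProjectionOnto x + W (Sᗮ.orthogonalProjectionOnto x) := rfl
  have horth {x : H} (hx : x ∈ (K.map S.subtype)ᗮ) (k : K) :
      ⟪S.orthogonalProjectionOnto x, (k : S)⟫_𝕜 = 0 := by
    rw [Submodule.inner_orthogonalProjectionOnto_eq_of_mem_right]
    exact (Submodule.mem_orthogonal' _ _).1 hx _ (Submodule.mem_map_of_mem k.2)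
  have hWg : (LinearMap.range W.toLinearMap)ᗮ.map K.subtype ≤
      ((K.map S.subtype)ᗮ.map g.toLinearMap)ᗮ := by
    rintro _ ⟨k, hk, rfl⟩
    rw [Submodule.mem_orthogonal]
    rintro _ ⟨x, hx, rfl⟩
    change ⟪g x, (k : S)⟫_𝕜 = 0
    rw [hg, inner_add_left, horth hx, zero_add]
    exact (Submodule.mem_orthogonal _ _).1 hk _ (LinearMap.mem_range_self _ _)
  refine ⟨g, fun s => ?_, fun x hx => ?_, fun _ => hW ?_⟩
  · rw [hg, Submodule.orthogonalProjectionOnto_orthogonal_apply_eq_zero s.2]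
    simp
  · refine (sq_eq_sq₀ (norm_nonneg _) (norm_nonneg _)).1 ?_
    rw [hg, sq, norm_add_sq_eq_norm_sq_add_norm_sq_of_inner_eq_zero _ _ (horth hx _),
      Submodule.norm_sq_eq_add_norm_sq_projection x S, ← W.norm_map, ← sq, ← sq]
    rfl
  · have := Submodule.finiteDimensional_of_le hWg
    exact (Submodule.equivMapOfInjective _ K.injective_subtype _).symm.finiteDimensional

variable {H E : Type*} [NormedAddCommGroup H] [InnerProductSpace ℂ H] [NormedAddCommGroup E]
  [InnerProductSpace ℂ E] [CompleteSpace H] [TopologicalSpace.SeparableSpace H] [CompleteSpace E]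
  {S T : Submodule ℂ H} [CompleteSpace S] [CompleteSpace T]

/-- The complement is the kernel of an operator onto `S` that is the identity on `S` and bijective
on `T`. -/
theorem haveCommonComplement_of_leftInverse {b : H →L[ℂ] E} {τ : E →L[ℂ] H} {K : Submodule ℂ S}
    [CompleteSpace K] (hbS : S ≤ b.ker) (hτ : ∀ e, τ e ∈ T) (hbτ : Function.LeftInverse b τ)
    (hTK : T ⊓ b.ker ≤ (K.map S.subtype)ᗮ) (hK : ¬ FiniteDimensional ℂ K)
    (hE : ¬ FiniteDimensional ℂ E) : HaveCommonComplement S T := by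
  have : SecondCountableTopology H := UniformSpace.secondCountable_of_separable H
  have : TopologicalSpace.SeparableSpace E := hbτ.surjective.denseRange.separableSpace b.continuous
  obtain ⟨g, hgS, hg, hgK⟩ := exists_retraction_norm_eq_on_orthogonal hK
  let T₀ : Submodule ℂ H := T ⊓ b.ker
  have hT₀ : IsClosed (T₀ : Set H) :=
    (completeSpace_coe_iff_isComplete.1 ‹CompleteSpace T›).isClosed.inter b.isClosed_ker
  have : CompleteSpace T₀ := hT₀.completeSpace_coe
  let g₀ : T₀ →ₗᵢ[ℂ] S := ⟨g.toLinearMap.domRestrict T₀, fun x => hg x (hTK x.2)⟩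
  have hR : IsClosed (T₀.map g.toLinearMap : Set S) := by
    rw [Submodule.map_coe, Set.image_eq_range]
    exact g₀.isometry.isClosedEmbedding.isClosed_range
  have : CompleteSpace (T₀.map g.toLinearMap) := hR.completeSpace_coe
  have hR_dim : ¬ FiniteDimensional ℂ (T₀.map g.toLinearMap)ᗮ := fun _ =>
    hgK (Submodule.finiteDimensional_of_le
      (Submodule.orthogonal_le (Submodule.map_mono hTK)))
  obtain ⟨U⟩ := nonempty_linearIsometryEquiv_of_not_finiteDimensional hE hR_dim
  let u : E →L[ℂ] S := (T₀.map g.toLinearMap)ᗮ.subtypeL ∘L (U : E →L[ℂ] _)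
  have hu : u.range = (T₀.map g.toLinearMap)ᗮ := by
    refine (LinearMap.range_comp_of_range_eq_top _ ?_).trans (Submodule.range_subtype _)
    exact LinearMap.range_eq_top.2 U.surjective
  let f : H →L[ℂ] S := g + (u - g ∘L τ) ∘L b
  have hfS : f.toLinearMap.domRestrict S = LinearMap.id := LinearMap.ext fun s => by
    have hbs : b s = 0 := hbS s.2
    simp [f, hgS, hbs]
  refine ⟨f.ker, f.isClosed_ker, isCompl_ker_of_bijective_domRestrict ?_,
    isCompl_ker_of_bijective_domRestrict (bijective_domRestrict_of_isCompl_map_range hτ hbτ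
      ?_ ?_ ?_)⟩
  · rw [hfS]
    exact Function.bijective_id
  · intro x hx y hy hxy
    exact congrArg Subtype.val (g₀.injective hxy : (⟨x, hx⟩ : T₀) = ⟨y, hy⟩)
  · exact Subtype.val_injective.comp U.injective
  · rw [hu]
    exact Submodule.isCompl_orthogonal (T₀.map g.toLinearMap)

theorem exists_mem_leftInverse_adjoint {𝕜 H E : Type*} [RCLike 𝕜] [NormedAddCommGroup H]
    [InnerProductSpace 𝕜 H] [CompleteSpace H] [NormedAddCommGroup E] [InnerProductSpace 𝕜 E]
    [CompleteSpace E] {T : Submodule 𝕜 H} [T.HasOrthogonalProjection] {a : E →L[𝕜] H}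
    (ha : (T.starProjection ∘L a).HasLeftInverse) :
    ∃ τ : E →L[𝕜] H, (∀ e, τ e ∈ T) ∧ Function.LeftInverse a.adjoint τ := by
  obtain ⟨L, hL⟩ := ha
  refine ⟨T.starProjection ∘L L.adjoint, fun e => Submodule.starProjection_apply_mem _ _,
    fun e => ext_inner_left 𝕜 fun x => ?_⟩
  rw [ContinuousLinearMap.adjoint_inner_right, ContinuousLinearMap.comp_apply,
    ← Submodule.inner_starProjection_left_eq_right, ContinuousLinearMap.adjoint_inner_right]
  exact congrArg (inner 𝕜 · e) (hL x)

theorem haveCommonComplement_of_hasLeftInverse {J : E →L[ℂ] H} (hE : ¬ FiniteDimensional ℂ E)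
    (hJ : ∀ e, J e ∈ Tᗮ) (hinv : (T.starProjection ∘L S.starProjection ∘L J).HasLeftInverse) :
    HaveCommonComplement S T := by
  obtain ⟨L, hL⟩ := hinv
  let J₀ : E →L[ℂ] S := S.orthogonalProjectionOnto ∘L J
  have hJ₀ : J₀.HasLeftInverse := ⟨L ∘L T.starProjection ∘L S.subtypeL, hL⟩
  have : CompleteSpace J₀.range := hJ₀.isClosed_range.completeSpace_coe
  have hJ₀_dim : ¬ FiniteDimensional ℂ J₀.range := fun _ =>
    hE (LinearEquiv.ofInjective J₀.toLinearMap hJ₀.injective).symm.finiteDimensional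
  let a : E →L[ℂ] H := Sᗮ.starProjection ∘L J
  have ha (e : E) : a e = J e - S.starProjection (J e) := S.starProjection_orthogonal_val _
  have hTa : (T.starProjection ∘L a).HasLeftInverse := ⟨-L, fun e => by
    rw [ContinuousLinearMap.comp_apply, ha, map_sub, T.starProjection_apply_eq_zero_iff.2 (hJ e),
      zero_sub, neg_apply, map_neg, neg_neg]
    exact hL e⟩
  have haS : S ≤ a.adjoint.ker := fun s hs => ext_inner_left ℂ fun e => by
    rw [ContinuousLinearMap.coe_coe, ContinuousLinearMap.adjoint_inner_right, inner_zero_right]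
    exact S.inner_left_of_mem_orthogonal hs (Submodule.starProjection_apply_mem _ _)
  obtain ⟨τ, hτ, haτ⟩ := exists_mem_leftInverse_adjoint hTa
  refine haveCommonComplement_of_leftInverse haS hτ haτ ?_ hJ₀_dim hE
  rintro x ⟨hxT, hxa⟩
  rw [Submodule.mem_orthogonal]
  rintro _ ⟨_, ⟨e, rfl⟩, rfl⟩
  have hax : ⟪a e, x⟫_ℂ = 0 := by
    have hx : a.adjoint x = 0 := hxa
    rw [← ContinuousLinearMap.adjoint_inner_right, hx, inner_zero_right]
  calc ⟪S.starProjection (J e), x⟫_ℂ = ⟪J e, x⟫_ℂ - ⟪a e, x⟫_ℂ := by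
        rw [← inner_sub_left, ha, sub_sub_cancel]
    _ = 0 := by rw [hax, sub_zero, T.inner_left_of_mem_orthogonal hxT (hJ e)]

end CommonComplement

section Projections

variable {H : Type*} [NormedAddCommGroup H] [InnerProductSpace ℂ H] [CompleteSpace H]

theorem haveCommonComplement_of_not_isCompactOperator [TopologicalSpace.SeparableSpace H]
    {P Q : H →L[ℂ] H} (hP : IsStarProjection P) (hQ : IsStarProjection Q)
    (hPQ : ¬ IsCompactOperator (Q * P * (1 - Q) : H →L[ℂ] H)) :
    HaveCommonComplement P.range Q.range := by
  obtain ⟨J, hJ⟩ := exists_linearIsometry_hasLeftInverse_of_not_isCompactOperator hPQ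
  obtain ⟨_, hPS⟩ := isStarProjection_iff_eq_starProjection_range.1 hP
  obtain ⟨_, hQT⟩ := isStarProjection_iff_eq_starProjection_range.1 hQ
  have : CompleteSpace P.range :=
    (ContinuousLinearMap.IsIdempotentElem.isClosed_range hP.isIdempotentElem).completeSpace_coe
  have : CompleteSpace Q.range :=
    (ContinuousLinearMap.IsIdempotentElem.isClosed_range hQ.isIdempotentElem).completeSpace_coe
  refine haveCommonComplement_of_hasLeftInverse (J := (1 - Q) ∘L J.toContinuousLinearMap)
    (not_finiteDimensional_lp_two ℕ) (fun e => ?_) ?_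
  · change J e - Q (J e) ∈ _
    nth_rw 2 [hQT]
    exact Submodule.sub_starProjection_mem_orthogonal (J e)
  · rwa [← hPS, ← hQT]

end Projections

section PrimeRing

variable {R : Type*} [Ring R] {p q : R}

/-- Here `(y * q - q * y) * p * (1 - q) - q * p * (y * q - q * y)` is the derivative of
`q * p * (1 - q)` as `q` moves with velocity `y * q - q * y`. -/
theorem mul_commutator_mul_one_sub_eq_zero (hq : IsIdempotentElem q) (hpq : q * p * (1 - q) = 0)
    {y : R} (hder : (y * q - q * y) * p * (1 - q) - q * p * (y * q - q * y) = 0) :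
    q * (p * y - y * p) * (1 - q) = 0 := by
  have hqp : q * p * q = q * p := by rwa [mul_sub, mul_one, sub_eq_zero, eq_comm] at hpq
  calc q * (p * y - y * p) * (1 - q)
      = ((y * q - q * y) * p * (1 - q) - q * p * (y * q - q * y)) * (1 - q)
        - y * (q * p * (1 - q)) * (1 - q) + q * y * p * ((1 - q) * (1 - q) - (1 - q))
        + q * p * y * (q * (1 - q)) + (q * p - q * p * q) * y * (1 - q) := by noncomm_ring
    _ = 0 := by simp [hder, hpq, hqp, hq.one_sub.eq, hq.mul_one_sub_self]

theorem eq_zero_or_eq_one_of_mul_commutator_mul_one_sub_eq_zero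
    (hR : ∀ a b : R, (∀ y, a * y * b = 0) → a = 0 ∨ b = 0) (hp : IsIdempotentElem p)
    (hcomm : ∀ y, q * (p * y - y * p) * (1 - q) = 0) : p = 0 ∨ p = 1 ∨ q = 0 ∨ q = 1 := by
  have hleft : q * p = 0 ∨ (1 - p) * (1 - q) = 0 := hR _ _ fun y => by
    have h := hcomm (y * (1 - p))
    rwa [mul_assoc y, hp.one_sub_mul_self, mul_zero, sub_zero, ← mul_assoc, ← mul_assoc,
      mul_assoc _ (1 - p)] at h
  have hright : q * (1 - p) = 0 ∨ p * (1 - q) = 0 := hR _ _ fun y => by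
    have h := hcomm (y * p)
    rw [mul_assoc y, hp.eq] at h
    calc q * (1 - p) * y * (p * (1 - q)) = -(q * (p * (y * p) - y * p) * (1 - q)) := by noncomm_ring
      _ = 0 := by rw [h, neg_zero]
  have eq_zero_of {e : R} (he : IsIdempotentElem e) (hqe : q * e = 0) (heq : e * (1 - q) = 0) :
      e = 0 :=
    calc e = e * (q * e) + e * (1 - q) * e := by rw [← mul_assoc, ← add_mul, ← mul_add,
          add_sub_cancel, mul_one, he.eq]
      _ = 0 := by rw [hqe, heq, mul_zero, zero_mul, add_zero]
  rcases hleft with hqp | hpq' <;> rcases hright with hqp' | hpq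
  · exact .inr (.inr (.inl (by simpa [mul_sub, hqp] using hqp')))
  · exact .inl (eq_zero_of hp hqp hpq)
  · exact .inr (.inl (sub_eq_zero.1 (eq_zero_of hp.one_sub hqp' hpq')).symm)
  · rw [sub_mul, hpq, sub_zero, one_mul, sub_eq_zero] at hpq'
    exact .inr (.inr (.inr hpq'.symm))

end PrimeRing

section CompactIdeal

variable (𝕜 E : Type*) [NontriviallyNormedField 𝕜] [NormedAddCommGroup E] [NormedSpace 𝕜 E]

/-- The two-sided ideal of compact operators on `E`. -/
def compactIdeal : TwoSidedIdeal (E →L[𝕜] E) :=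
  .mk' {A | IsCompactOperator A} isCompactOperator_zero (fun hA hB => hA.add hB)
    (fun hA => hA.neg) (fun {A _} hB => hB.clm_comp A) (fun {_ B} hA => hA.comp_clm B)

/-- The Calkin algebra of `E`: bounded operators modulo compact operators. -/
abbrev CalkinAlgebra : Type _ := (compactIdeal 𝕜 E).ringCon.Quotient

/-- The quotient map onto the Calkin algebra. -/
abbrev toCalkin : (E →L[𝕜] E) →+* CalkinAlgebra 𝕜 E := (compactIdeal 𝕜 E).ringCon.mk'

variable {𝕜 E}

theorem toCalkin_surjective : Function.Surjective (toCalkin 𝕜 E) := RingCon.mk'_surjective _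

theorem toCalkin_eq_zero_iff {A : E →L[𝕜] E} : toCalkin 𝕜 E A = 0 ↔ IsCompactOperator A := by
  rw [← TwoSidedIdeal.mem_ker, TwoSidedIdeal.ker_ringCon_mk']
  exact TwoSidedIdeal.mem_mk' _ _ _ _ _ _ A

end CompactIdeal

section Calkin

variable {𝕜 E : Type*} [RCLike 𝕜] [NormedAddCommGroup E] [InnerProductSpace 𝕜 E]
  [CompleteSpace E]

theorem calkinAlgebra_eq_zero_or_eq_zero_of_forall_mul_mul_eq_zero (a b : CalkinAlgebra 𝕜 E)
    (h : ∀ y, a * y * b = 0) : a = 0 ∨ b = 0 := by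
  obtain ⟨A, rfl⟩ := toCalkin_surjective a
  obtain ⟨B, rfl⟩ := toCalkin_surjective b
  simp only [toCalkin_eq_zero_iff]
  refine isCompactOperator_or_isCompactOperator_of_forall_comp fun Y => ?_
  have hY := h (toCalkin 𝕜 E Y)
  rwa [← map_mul, ← map_mul, toCalkin_eq_zero_iff, mul_assoc] at hY

theorem exists_not_isCompactOperator_derivative {P Q : E →L[𝕜] E} (hP : IsIdempotentElem P)
    (hQ : IsIdempotentElem Q) (hP₀ : ¬ IsCompactOperator P)
    (hP₁ : ¬ IsCompactOperator (1 - P : E →L[𝕜] E))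
    (hQ₀ : ¬ IsCompactOperator Q) (hQ₁ : ¬ IsCompactOperator (1 - Q : E →L[𝕜] E))
    (hPQ : IsCompactOperator (Q * P * (1 - Q) : E →L[𝕜] E)) :
    ∃ Y : E →L[𝕜] E, ¬ IsCompactOperator
      ((Y * Q - Q * Y) * P * (1 - Q) - Q * P * (Y * Q - Q * Y) : E →L[𝕜] E) := by
  by_contra! h
  rw [← toCalkin_eq_zero_iff] at hP₀ hP₁ hQ₀ hQ₁ hPQ
  rw [map_sub, map_one, sub_eq_zero, eq_comm] at hP₁ hQ₁
  simp only [map_mul, map_sub, map_one] at hPQ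
  have := eq_zero_or_eq_one_of_mul_commutator_mul_one_sub_eq_zero
    calkinAlgebra_eq_zero_or_eq_zero_of_forall_mul_mul_eq_zero (hP.map (toCalkin 𝕜 E)) fun y => by
      obtain ⟨Y, rfl⟩ := toCalkin_surjective y
      refine mul_commutator_mul_one_sub_eq_zero (hQ.map _) hPQ ?_
      simpa only [map_mul, map_sub, map_one] using toCalkin_eq_zero_iff.2 (h Y)
  tauto

end Calkin

section SkewAdjoint

theorem eq_top_of_skewAdjoint_subset {A : Type*} [AddCommGroup A] [Module ℂ A] [StarAddMonoid A]
    [StarModule ℂ A] {S : Submodule ℂ A} (hS : (skewAdjoint A : Set A) ⊆ S) : S = ⊤ := by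
  rw [eq_top_iff, ← span_selfAdjoint, Submodule.span_le]
  intro z hz
  have hIz : Complex.I • z ∈ S := hS (IsSelfAdjoint.smul_mem_skewAdjoint Complex.conj_I hz)
  exact (S.smul_mem_iff Complex.I_ne_zero).1 hIz

end SkewAdjoint

section InfProjections

variable {H : Type*} [NormedAddCommGroup H] [InnerProductSpace ℂ H] [CompleteSpace H]

theorem mem_infProjections_iff {P : H →L[ℂ] H} : P ∈ infProjections H ↔
    IsStarProjection P ∧ ¬ IsCompactOperator P ∧ ¬ IsCompactOperator (1 - P : H →L[ℂ] H) := by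
  refine and_congr_right fun hP => ?_
  have hP' := hP.isIdempotentElem
  have hker : P.ker = (1 - P).range :=
    LinearMap.IsIdempotentElem.ker_eq_range_one_sub
      (ContinuousLinearMap.IsIdempotentElem.toLinearMap hP')
  rw [isCompactOperator_iff_finiteDimensional_range_of_isIdempotentElem hP',
    isCompactOperator_iff_finiteDimensional_range_of_isIdempotentElem hP'.one_sub, ← hker]

theorem exists_skewAdjoint_not_isCompactOperator_derivative {P Q : H →L[ℂ] H}
    (hP : P ∈ infProjections H) (hQ : Q ∈ infProjections H)
    (hPQ : IsCompactOperator (Q * P * (1 - Q) : H →L[ℂ] H)) :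
    ∃ Y ∈ skewAdjoint (H →L[ℂ] H), ¬ IsCompactOperator
      ((Y * Q - Q * Y) * P * (1 - Q) - Q * P * (Y * Q - Q * Y) : H →L[ℂ] H) := by
  rw [mem_infProjections_iff] at hP hQ
  obtain ⟨Y, hY⟩ := exists_not_isCompactOperator_derivative hP.1.isIdempotentElem
    hQ.1.isIdempotentElem hP.2.1 hP.2.2 hQ.2.1 hQ.2.2 hPQ
  by_contra! h
  let ad := LinearMap.mulRight ℂ Q - LinearMap.mulLeft ℂ Q
  let D := LinearMap.mulRight ℂ (1 - Q) ∘ₗ LinearMap.mulRight ℂ P ∘ₗ ad -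
    LinearMap.mulLeft ℂ (Q * P) ∘ₗ ad
  have htop : (compactOperator (RingHom.id ℂ) H H).comap D = ⊤ := eq_top_of_skewAdjoint_subset h
  exact hY (htop ▸ Submodule.mem_top : Y ∈ (compactOperator (RingHom.id ℂ) H H).comap D)

theorem isCompactOperator_conjStarAlgAut_iff (u : unitary (H →L[ℂ] H)) {A : H →L[ℂ] H} :
    IsCompactOperator (Unitary.conjStarAlgAut ℂ _ u A) ↔ IsCompactOperator A := by
  have key (v : unitary (H →L[ℂ] H)) {B : H →L[ℂ] H} (hB : IsCompactOperator B) :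
      IsCompactOperator (Unitary.conjStarAlgAut ℂ _ v B) :=
    (hB.clm_comp (v : H →L[ℂ] H)).comp_clm (star v : H →L[ℂ] H)
  refine ⟨fun h => ?_, key u⟩
  have := key (star u) h
  rwa [← Unitary.conjStarAlgAut_symm, StarAlgEquiv.symm_apply_apply] at this

theorem conjStarAlgAut_mem_infProjections (u : unitary (H →L[ℂ] H)) {Q : H →L[ℂ] H}
    (hQ : Q ∈ infProjections H) : Unitary.conjStarAlgAut ℂ _ u Q ∈ infProjections H := by
  rw [mem_infProjections_iff] at hQ ⊢
  rw [← map_one (Unitary.conjStarAlgAut ℂ _ u), ← map_sub, isCompactOperator_conjStarAlgAut_iff,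
    isCompactOperator_conjStarAlgAut_iff]
  exact ⟨hQ.1.map _, hQ.2⟩

end InfProjections

section Perturbation

open Filter Topology

theorem hasDerivAt_exp_smul_mul_mul_star {A : Type*} [NormedRing A] [NormedAlgebra ℝ A]
    [CompleteSpace A] [StarRing A] [NormedStarGroup A] [StarModule ℝ A] {y : A}
    (hy : y ∈ skewAdjoint A) (q : A) :
    HasDerivAt (fun t : ℝ => NormedSpace.exp (t • y) * q * star (NormedSpace.exp (t • y)))
      (y * q - q * y) 0 := by
  have hexp := hasDerivAt_exp_smul_const (𝕂 := ℝ) y 0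
  have h := (hexp.mul_const q).mul hexp.star
  rw [zero_smul, NormedSpace.exp_zero, star_mul, star_one, skewAdjoint.mem_iff.1 hy, one_mul,
    mul_one, mul_one, one_mul, mul_neg, ← sub_eq_add_neg] at h
  exact h

theorem frequently_not_isCompactOperator_of_hasDerivAt {𝕜 E F : Type*} [NontriviallyNormedField 𝕜]
    [NormedAddCommGroup E] [NormedSpace 𝕜 E] [NormedAddCommGroup F] [NormedSpace 𝕜 F]
    [NormedSpace ℝ F] [SMulCommClass 𝕜 ℝ F] [CompleteSpace F] {f : ℝ → E →L[𝕜] F}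
    {f' : E →L[𝕜] F} {t₀ : ℝ} (hf : HasDerivAt f f' t₀) (hf' : ¬ IsCompactOperator f') :
    ∃ᶠ t in 𝓝 t₀, ¬ IsCompactOperator (f t) := by
  intro hcompact
  simp only [not_not] at hcompact
  refine hf' (isCompactOperator_of_tendsto hf.tendsto_slope ?_)
  filter_upwards [nhdsWithin_le_nhds hcompact] with t ht
  rw [slope_def_module]
  exact (ht.sub hcompact.self_of_nhds).smul _

variable {H : Type*} [NormedAddCommGroup H] [InnerProductSpace ℂ H] [CompleteSpace H]

theorem exists_tendsto_frequently_not_isCompactOperator {P Q : H →L[ℂ] H}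
    (hP : P ∈ infProjections H) (hQ : Q ∈ infProjections H) :
    ∃ q : ℝ → H →L[ℂ] H, (∀ t, q t ∈ infProjections H) ∧ Tendsto q (𝓝 0) (𝓝 Q) ∧
      ∃ᶠ t in 𝓝 0, ¬ IsCompactOperator (q t * P * (1 - q t) : H →L[ℂ] H) := by
  by_cases hPQ : IsCompactOperator (Q * P * (1 - Q) : H →L[ℂ] H)
  swap
  · exact ⟨fun _ => Q, fun _ => hQ, tendsto_const_nhds, .of_forall fun _ => hPQ⟩
  obtain ⟨Y, hY, hYK⟩ := exists_skewAdjoint_not_isCompactOperator_derivative hP hQ hPQ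
  let : NormedAlgebra ℚ (H →L[ℂ] H) := .restrictScalars ℚ ℂ (H →L[ℂ] H)
  let q (t : ℝ) : H →L[ℂ] H := NormedSpace.exp (t • Y) * Q * star (NormedSpace.exp (t • Y))
  have hq₀ : q 0 = Q := by simp [q]
  have hq : HasDerivAt q (Y * Q - Q * Y) 0 := hasDerivAt_exp_smul_mul_mul_star hY Q
  have hunitary (t : ℝ) : NormedSpace.exp (t • Y) ∈ unitary (H →L[ℂ] H) :=
    NormedSpace.exp_mem_unitary_of_mem_skewAdjoint (skewAdjoint.smul_mem t hY)
  refine ⟨q, fun t => conjStarAlgAut_mem_infProjections ⟨_, hunitary t⟩ hQ,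
    by simpa only [hq₀] using hq.continuousAt.tendsto, ?_⟩
  refine frequently_not_isCompactOperator_of_hasDerivAt
    ((hq.mul_const P).mul (hq.const_sub 1)) ?_
  rwa [hq₀, mul_neg, ← sub_eq_add_neg]

end Perturbation

/-- `Δ_∞` is dense in the space `P_{∞,∞} × P_{∞,∞}`, with the topology of the operator norm. -/
theorem mainTheorem3 (H : Type*) [NormedAddCommGroup H] [InnerProductSpace ℂ H]
    [CompleteSpace H] [TopologicalSpace.SeparableSpace H] :
    Dense {x : ↥(infProjections H ×ˢ infProjections H) |
      (x : (H →L[ℂ] H) × (H →L[ℂ] H)) ∈ commonComplementPairsInf H} := by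
  rintro ⟨⟨P, Q⟩, hP, hQ⟩
  obtain ⟨q, hq, hlim, hfreq⟩ := exists_tendsto_frequently_not_isCompactOperator hP hQ
  refine mem_closure_of_frequently_of_tendsto
    (f := fun t => (⟨(P, q t), hP, hq t⟩ : ↥(infProjections H ×ˢ infProjections H)))
    (hfreq.mono fun t ht => ?_) (tendsto_subtype_rng.2 (tendsto_const_nhds.prodMk_nhds hlim))
  exact ⟨⟨hP.1, (hq t).1, haveCommonComplement_of_not_isCompactOperator hP.1 (hq t).1 ht⟩,
    hP, hq t⟩
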